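/- Let $L$ be the left shift $(L\Psi)(x)=\Psi(x+1)$ on $\ell^2(\mathbb{Z})=\ell^2(\mathbb{Z},\mathbb{C})$, with adjoint $L^*$. Let $p\in\mathbb{R}$ and $q\in\mathbb{C}\setminus\{0\}$ satisfy $p^2+|q|^2=1$, put $\theta=\mathrm{Arg}\,q$, and let $a_1,a_2:\mathbb{Z}\to\mathbb{R}$ and $b:\mathbb{Z}\to\mathbb{C}$ satisfy $a_j(x)^2+|b(x)|^2=1$ ($j=1,2$) and $b(x)(a_1(x)+a_2(x))=0$ for all $x\in\mathbb{Z}$. On $\mathcal{H}=\ell^2(\mathbb{Z})\oplus\ell^2(\mathbb{Z})$ consider the split-step supersymmetric quantum walk $(\varGamma,C)$ given by \[ \varGamma=\begin{pmatrix} p & qL\\ q^*L^* & -p\end{pmatrix},\qquad C=\begin{pmatrix} a_1 & b^*\\ b & a_2\end{pmatrix}, \] where sequences act as multiplication operators, its supercharge $Q=\frac{1}{2i}[\varGamma,C]$, and the unitary operator \[ \epsilon=\frac{1}{\sqrt2}\begin{pmatrix}\sqrt{1+p} & -\sqrt{1-p}\\ \sqrt{1-p}\,e^{-i\theta}L^*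 & \sqrt{1+p}\,e^{-i\theta}L^*\end{pmatrix}. \] Let $Q_{\epsilon_+}:\ell^2(\mathbb{Z})\to\ell^2(\mathbb{Z})$ be the lower left entry of the block matrix of $\epsilon^*Q\epsilon$ (which is block off-diagonal); explicitly, \[ -2iQ_{\epsilon_+}=(1+p)e^{i\theta}Lb-(1-p)e^{-i\theta}b^*L^*+|q|\,(a_2(\cdot+1)-a_1). \] Suppose that the coin is anisotropic, that is, the limits \[ C(\mathrm{L})=\lim_{x\to-\infty}C(x),\qquad C(\mathrm{R})=\lim_{x\to+\infty}C(x) \] of the matrices $C(x)=\begin{pmatrix} a_1(x) & b(x)^*\\ b(x) & a_2(x)\end{pmatrix}$ exist, and write $a(\sharp)$ for the upper left entry of $C(\sharp)$ ($\sharp=\mathrm{L},\mathrm{R}$). Then $Q_{\epsilon_+}$ has a closed range if and only if $|p|\neq|a(\sharp)|$ for every $\sharp\in\{\mathrm{L},\mathrm{R}\}$ for which $C(\sharp)$ is non-diagonal. -/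

import Mathlib

open Filter Topology
open scoped ComplexConjugate InnerProductSpace InnerProduct

noncomputable section

namespace QuantumWalk

/-- The Hilbert space `ℓ²(ℤ) = ℓ²(ℤ, ℂ)`. -/
abbrev EllTwo : Type := lp (fun _ : ℤ => ℂ) 2

/-- The state space `ℓ²(ℤ) ⊕ ℓ²(ℤ)` (Hilbert space direct sum), identified with `ℓ²(ℤ, ℂ²)`. -/
abbrev StateSpace : Type := WithLp 2 (EllTwo × EllTwo)

theorem memlp_shift (f : EllTwo) : Memℓp (fun x : ℤ => f (x + 1)) 2 := by
  refine memℓp_gen ?_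
  have h := (lp.memℓp f).summable (by norm_num)
  exact (Equiv.addRight (1 : ℤ)).summable_iff.mpr h

/-- The left shift `(L Ψ)(x) = Ψ (x + 1)` on `ℓ²(ℤ)`; the right shift is its adjoint. -/
def leftShift : EllTwo →L[ℂ] EllTwo :=
  LinearMap.mkContinuous
    { toFun := fun f => ⟨fun x : ℤ => f (x + 1), memlp_shift f⟩
      map_add' := fun _ _ => rfl
      map_smul' := fun _ _ => rfl }
    1
    (fun f => by
      rw [one_mul]
      refine lp.norm_le_of_tsum_le (by norm_num) (norm_nonneg _) ?_
      rw [lp.norm_rpow_eq_tsum (by norm_num) f]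
      exact le_of_eq ((Equiv.addRight (1 : ℤ)).tsum_eq
        (fun x : ℤ => ‖f x‖ ^ (2 : ENNReal).toReal)))

@[simp] theorem leftShift_apply (f : EllTwo) (x : ℤ) : leftShift f x = f (x + 1) := rfl

/-- The right shift `L*`. -/
def rightShift : EllTwo →L[ℂ] EllTwo := ContinuousLinearMap.adjoint leftShift

/-- Multiplication on `ℓ²(ℤ)` by a sequence that is bounded by `1`. -/
def mulOp (c : ℤ → ℂ) (hc : ∀ x, ‖c x‖ ≤ 1) : EllTwo →L[ℂ] EllTwo :=
  lp.mapCLM 2 (fun x => ContinuousLinearMap.mul ℂ ℂ (c x)) zero_le_one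
    (fun x => by simpa using hc x)

@[simp] theorem mulOp_apply (c : ℤ → ℂ) (hc : ∀ x, ‖c x‖ ≤ 1) (f : EllTwo) (x : ℤ) :
    mulOp c hc f x = c x * f x := by
  simp [mulOp]

/-- The operator on `ℓ²(ℤ) ⊕ ℓ²(ℤ)` with block matrix `(A B; C D)`. -/
def blockOp (A B C D : EllTwo →L[ℂ] EllTwo) : StateSpace →L[ℂ] StateSpace :=
  (WithLp.prodContinuousLinearEquiv 2 ℂ EllTwo EllTwo).symm.toContinuousLinearMap ∘L
    ((A ∘L WithLp.fstL 2 ℂ EllTwo EllTwo + B ∘L WithLp.sndL 2 ℂ EllTwo EllTwo).prod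
      (C ∘L WithLp.fstL 2 ℂ EllTwo EllTwo + D ∘L WithLp.sndL 2 ℂ EllTwo EllTwo))

/-- The lower left entry of the block matrix of an operator on `ℓ²(ℤ) ⊕ ℓ²(ℤ)`,
that is, `Ψ ↦ (T (Ψ, 0))₂`. -/
def lowerLeft (T : StateSpace →L[ℂ] StateSpace) : EllTwo →L[ℂ] EllTwo :=
  WithLp.sndL 2 ℂ EllTwo EllTwo ∘L T ∘L
    (WithLp.prodContinuousLinearEquiv 2 ℂ EllTwo EllTwo).symm.toContinuousLinearMap ∘L
      ContinuousLinearMap.inl ℂ EllTwo EllTwo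

/-- The data `(p, q, a₁, a₂, b)` that determine a one-dimensional split-step SUSYQW. -/
structure SplitStep where
  /-- The real shift parameter. -/
  p : ℝ
  /-- The complex shift parameter. -/
  q : ℂ
  /-- The upper diagonal entry of the coin. -/
  a₁ : ℤ → ℝ
  /-- The lower diagonal entry of the coin. -/
  a₂ : ℤ → ℝ
  /-- The lower left entry of the coin. -/
  b : ℤ → ℂ
  q_ne_zero : q ≠ 0
  shift_cond : p ^ 2 + ‖q‖ ^ 2 = 1
  coin_cond₁ : ∀ x, a₁ x ^ 2 + ‖b x‖ ^ 2 = 1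
  coin_cond₂ : ∀ x, a₂ x ^ 2 + ‖b x‖ ^ 2 = 1
  coin_cond₃ : ∀ x, b x * ((a₁ x : ℂ) + (a₂ x : ℂ)) = 0

namespace SplitStep

variable (W : SplitStep)

theorem norm_a₁_le (x : ℤ) : ‖(W.a₁ x : ℂ)‖ ≤ 1 := by
  rw [Complex.norm_real, Real.norm_eq_abs]
  exact (sq_le_one_iff_abs_le_one _).mp (by nlinarith [W.coin_cond₁ x, sq_nonneg ‖W.b x‖])

theorem norm_a₂_le (x : ℤ) : ‖(W.a₂ x : ℂ)‖ ≤ 1 := by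
  rw [Complex.norm_real, Real.norm_eq_abs]
  exact (sq_le_one_iff_abs_le_one _).mp (by nlinarith [W.coin_cond₂ x, sq_nonneg ‖W.b x‖])

theorem norm_b_le (x : ℤ) : ‖W.b x‖ ≤ 1 := by
  nlinarith [W.coin_cond₁ x, sq_nonneg (W.a₁ x), norm_nonneg (W.b x)]

theorem norm_conj_b_le (x : ℤ) : ‖conj (W.b x)‖ ≤ 1 := by
  rw [RCLike.norm_conj]
  exact W.norm_b_le x

/-- The shift operator `Γ = (p, q L; q* L*, -p)`. -/
def shift : StateSpace →L[ℂ] StateSpace :=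
  blockOp ((W.p : ℂ) • ContinuousLinearMap.id ℂ EllTwo) (W.q • leftShift)
    (conj W.q • rightShift) (-((W.p : ℂ) • ContinuousLinearMap.id ℂ EllTwo))

/-- The coin operator `C = (a₁, b*; b, a₂)`, whose entries are multiplication operators. -/
def coin : StateSpace →L[ℂ] StateSpace :=
  blockOp (mulOp (fun x => (W.a₁ x : ℂ)) W.norm_a₁_le)
    (mulOp (fun x => conj (W.b x)) W.norm_conj_b_le)
    (mulOp W.b W.norm_b_le)
    (mulOp (fun x => (W.a₂ x : ℂ)) W.norm_a₂_le)

/-- The coin matrix `C(x)` at the site `x`. -/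
def coinMatrix (x : ℤ) : Matrix (Fin 2) (Fin 2) ℂ :=
  !![(W.a₁ x : ℂ), conj (W.b x); W.b x, (W.a₂ x : ℂ)]

/-- The supercharge `Q = [Γ, C] / 2i`. -/
def supercharge : StateSpace →L[ℂ] StateSpace :=
  (2 * Complex.I)⁻¹ • (W.shift ∘L W.coin - W.coin ∘L W.shift)

/-- The unitary operator
`ε = (1/√2) (√(1+p), -√(1-p); √(1-p) e^{-iθ} L*, √(1+p) e^{-iθ} L*)`, where `θ = Arg q`. -/
def eps : StateSpace →L[ℂ] StateSpace :=
  ((1 / √2 : ℝ) : ℂ) • blockOp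
    ((√(1 + W.p) : ℂ) • ContinuousLinearMap.id ℂ EllTwo)
    (-((√(1 - W.p) : ℂ) • ContinuousLinearMap.id ℂ EllTwo))
    (((√(1 - W.p) : ℂ) * Complex.exp (-(Complex.I * (W.q.arg : ℂ)))) • rightShift)
    (((√(1 + W.p) : ℂ) * Complex.exp (-(Complex.I * (W.q.arg : ℂ)))) • rightShift)

/-- The operator `Q_{ε₊}` on `ℓ²(ℤ)`: the lower left entry of the block matrix of `ε* Q ε`. -/
def QepsPlus : EllTwo →L[ℂ] EllTwo :=
  lowerLeft (ContinuousLinearMap.adjoint W.eps ∘L W.supercharge ∘L W.eps)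

/-- The coin is anisotropic with limit coins `CL = C(-∞)` and `CR = C(+∞)`. -/
def IsAnisotropic (CL CR : Matrix (Fin 2) (Fin 2) ℂ) : Prop :=
  Tendsto W.coinMatrix atBot (𝓝 CL) ∧ Tendsto W.coinMatrix atTop (𝓝 CR)

end SplitStep

end QuantumWalk

end

/-! ### Explicit three-term form of the operator -/

namespace QuantumWalk

/-! Expanding ε*Qε exhibits `QepsPlus` as a three-term operator uL + v + wL* (`QepsPlus_apply`), so
closedness of its range is decided at the two ends of ℤ. Where the limit coin has opposite diagonal
entries a and -a, the coefficients converge to those of a product (αL + β)(γ + δL*). For a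
non-diagonal limit the factors vanish somewhere on the unit circle exactly when p = a, respectively
p = -a (`exists_hasFactoredLimit`). Where the diagonal entries do not sum to zero, the coefficients
are eventually exactly zero (`eventually_coeff_eq_zero`).

If no factor vanishes on the circle, the operator is bounded below on sequences supported far out,
since L is unitary. So at a good end the image of such sequences is closed or zero; the two images
have disjoint supports and the remaining middle part is finite-dimensional
(`IsJacobi.isClosed_range`).

If a factor vanishes on the circle, long truncated plane waves are approximate kernel vectors. They
could still lie close to the kernel, but b ≠ 0 near that end, so the recurrence leaves kernel
vectors only two degrees of freedom there. Three disjointly supported waves are too many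
(`not_isClosed_range_of_approx_kernel`). -/

theorem rightShift_apply (f : EllTwo) (x : ℤ) : rightShift f x = f (x - 1) := by
  have h1 := lp.inner_single_left (𝕜 := ℂ) (G := fun _ : ℤ => ℂ) x (1 : ℂ) (rightShift f)
  have h2 := lp.inner_single_left (𝕜 := ℂ) (G := fun _ : ℤ => ℂ) (x - 1) (1 : ℂ) f
  have h3 : leftShift (lp.single 2 x (1 : ℂ)) = lp.single 2 (x - 1) (1 : ℂ) := by
    ext y
    simp only [leftShift_apply, lp.single_apply, Pi.single_apply]
    congr 1
    simp only [eq_iff_iff]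
    lia
  rw [rightShift, ContinuousLinearMap.adjoint_inner_right, h3, h2] at h1
  simpa [rightShift] using h1.symm

theorem leftShift_rightShift (f : EllTwo) : leftShift (rightShift f) = f := by
  ext x
  simp [rightShift_apply]

theorem rightShift_leftShift (f : EllTwo) : rightShift (leftShift f) = f := by
  ext x
  simp [rightShift_apply]

theorem adjoint_rightShift : ContinuousLinearMap.adjoint rightShift = leftShift := by
  simp [rightShift]

theorem blockOp_apply_fst (A B C D : EllTwo →L[ℂ] EllTwo) (f : StateSpace) :
    (blockOp A B C D f).ofLp.1 = A f.ofLp.1 + B f.ofLp.2 := rfl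

theorem blockOp_apply_snd (A B C D : EllTwo →L[ℂ] EllTwo) (f : StateSpace) :
    (blockOp A B C D f).ofLp.2 = C f.ofLp.1 + D f.ofLp.2 := rfl

theorem adjoint_blockOp (A B C D : EllTwo →L[ℂ] EllTwo) :
    ContinuousLinearMap.adjoint (blockOp A B C D) =
      blockOp (ContinuousLinearMap.adjoint A) (ContinuousLinearMap.adjoint C)
        (ContinuousLinearMap.adjoint B) (ContinuousLinearMap.adjoint D) := by
  symm
  rw [ContinuousLinearMap.eq_adjoint_iff]
  intro f g
  simp only [WithLp.prod_inner_apply, blockOp_apply_fst, blockOp_apply_snd, inner_add_left,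
    inner_add_right, ContinuousLinearMap.adjoint_inner_left]
  ring

theorem lowerLeft_apply (T : StateSpace →L[ℂ] StateSpace) (f : EllTwo) :
    lowerLeft T f = (T (WithLp.toLp 2 (f, 0))).ofLp.2 := rfl

namespace SplitStep

variable (W : SplitStep)

theorem adjoint_eps_apply_snd (f : StateSpace) (x : ℤ) :
    (ContinuousLinearMap.adjoint W.eps f).ofLp.2 x =
      ((1 / √2 : ℝ) : ℂ) * (-((√(1 - W.p) : ℂ) * f.ofLp.1 x) +
        (√(1 + W.p) : ℂ) * Complex.exp (Complex.I * (W.q.arg : ℂ)) * f.ofLp.2 (x + 1)) := by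
  have h : conj (Complex.exp (-(Complex.I * (W.q.arg : ℂ)))) =
      Complex.exp (Complex.I * (W.q.arg : ℂ)) := by
    rw [← Complex.exp_conj]
    simp
  rw [eps, map_smulₛₗ, adjoint_blockOp]
  simp only [map_smulₛₗ, map_neg, map_mul, h, Complex.conj_ofReal, adjoint_rightShift,
    ContinuousLinearMap.adjoint_id, smul_apply, WithLp.ofLp_smul,
    Prod.smul_snd, blockOp_apply_snd, neg_apply, ContinuousLinearMap.id_apply,
    lp.coeFn_smul, lp.coeFn_add, lp.coeFn_neg, Pi.smul_apply, Pi.add_apply, Pi.neg_apply,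
    smul_eq_mul, leftShift_apply]

theorem norm_q_eq : ‖W.q‖ = √(1 + W.p) * √(1 - W.p) := by
  rw [← Real.sqrt_mul, eq_comm, Real.sqrt_eq_iff_mul_self_eq]
  all_goals nlinarith [W.shift_cond, norm_nonneg W.q]

theorem q_eq : W.q = (√(1 + W.p) : ℂ) * (√(1 - W.p) : ℂ) *
    Complex.exp (Complex.I * (W.q.arg : ℂ)) := by
  rw [← Complex.ofReal_mul, ← norm_q_eq, mul_comm Complex.I, Complex.norm_mul_exp_arg_mul_I]

theorem abs_p_lt_one : |W.p| < 1 := by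
  rw [← sq_lt_one_iff_abs_lt_one]
  have := norm_pos_iff.mpr W.q_ne_zero
  nlinarith [W.shift_cond]

theorem sq_sqrt_one_add : (√(1 + W.p) : ℂ) ^ 2 = 1 + W.p := by
  rw [← Complex.ofReal_pow, Real.sq_sqrt (by linarith [(abs_lt.mp W.abs_p_lt_one).1])]
  push_cast
  ring

theorem sq_sqrt_one_sub : (√(1 - W.p) : ℂ) ^ 2 = 1 - W.p := by
  rw [← Complex.ofReal_pow, Real.sq_sqrt (by linarith [(abs_lt.mp W.abs_p_lt_one).2])]
  push_cast
  ring

theorem QepsPlus_apply (f : EllTwo) (x : ℤ) :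
    W.QepsPlus f x = (Complex.I / 2) *
      ((1 + W.p) * Complex.exp (Complex.I * (W.q.arg : ℂ)) * W.b (x + 1) * f (x + 1) +
        ‖W.q‖ * (W.a₂ (x + 1) - W.a₁ x) * f x -
        (1 - W.p) * Complex.exp (-(Complex.I * (W.q.arg : ℂ))) * conj (W.b x) * f (x - 1)) := by
  rw [QepsPlus, lowerLeft_apply]
  simp only [ContinuousLinearMap.comp_apply, adjoint_eps_apply_snd]
  simp only [supercharge, shift, coin, eps, smul_apply, WithLp.ofLp_smul,
    sub_apply, ContinuousLinearMap.comp_apply, map_smul, map_add, map_neg,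
    WithLp.ofLp_sub, Prod.smul_fst, Prod.fst_sub, Prod.snd_sub, map_zero, add_zero,
    Prod.smul_snd, blockOp_apply_snd, blockOp_apply_fst, neg_apply,
    ContinuousLinearMap.id_apply, rightShift_apply, mulOp_apply,
    lp.coeFn_smul, lp.coeFn_add, lp.coeFn_neg, lp.coeFn_sub, Pi.smul_apply, Pi.add_apply,
    Pi.neg_apply, Pi.sub_apply, smul_eq_mul, leftShift_apply, add_sub_cancel_right]
  have hq := W.q_eq
  have hn := W.norm_q_eq
  have hs := W.sq_sqrt_one_add
  have ht := W.sq_sqrt_one_sub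
  have hq' : conj W.q = (√(1 + W.p) : ℂ) * (√(1 - W.p) : ℂ) *
      Complex.exp (-(Complex.I * (W.q.arg : ℂ))) := by
    conv_lhs => rw [hq]
    simp [← Complex.exp_conj]
  have he : Complex.exp (Complex.I * (W.q.arg : ℂ)) *
      Complex.exp (-(Complex.I * (W.q.arg : ℂ))) = 1 := by
    rw [← Complex.exp_add, add_neg_cancel, Complex.exp_zero]
  have hk : ((1 / √2 : ℝ) : ℂ) ^ 2 = 1 / 2 := by
    rw [← Complex.ofReal_pow, div_pow, Real.sq_sqrt (by norm_num)]
    norm_num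
  have hI : (2 * Complex.I)⁻¹ = -(Complex.I / 2) := by
    rw [mul_inv, Complex.inv_I]
    ring
  have hn' : (‖W.q‖ : ℂ) = (√(1 + W.p) : ℂ) * (√(1 - W.p) : ℂ) := by
    rw [hn, Complex.ofReal_mul]
  rw [hI, hn', hq', ← hs, ← ht]
  -- Once the scalars are opaque and q is s t e, the claim is a polynomial identity modulo e e' = 1,
  -- s² = 1 + p, t² = 1 - p and k² = 1/2.
  generalize conj (W.b x) = b'
  generalize W.b (x + 1) = b1 at *
  generalize f x = f0 at *
  generalize f (x + 1) = f1 at *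
  generalize f (x - 1) = f2 at *
  generalize (W.a₁ x : ℂ) = a at *
  generalize (W.a₂ (x + 1) : ℂ) = a2 at *
  generalize Complex.exp (Complex.I * (W.q.arg : ℂ)) = e at *
  generalize Complex.exp (-(Complex.I * (W.q.arg : ℂ))) = e' at *
  generalize (√(1 + W.p) : ℂ) = s at *
  generalize (√(1 - W.p) : ℂ) = t at *
  generalize ((1 / √2 : ℝ) : ℂ) = k at *
  generalize (W.p : ℂ) = p at *
  generalize W.q = q at *
  subst hq
  linear_combination
    (-(Complex.I / 2) *
      (-(t * (s * (p * (a * f0)) + t * e' * (p * (b' * f2)) +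
          (s * (s * t * e * (b1 * f1)) + t * e' * (s * t * e * (a2 * f0))) -
          (s * (p * (a * f0)) + t * e' * (s * t * e * (a * f0)) +
            (s * (s * t * e' * (b' * f2)) + t * e' * -(p * (b' * f2)))))) +
        s * e * (s * (s * t * e' * (a * f0)) + t * e' * (s * t * e' * (b' * f2)) +
          (s * -(p * (b1 * f1)) + t * e' * -(p * (a2 * f0))) -
          (s * (p * (b1 * f1)) + t * e' * (s * t * e * (b1 * f1)) +
            (s * (s * t * e' * (a2 * f0)) + t * e' * -(p * (a2 * f0))))))) * hk -
    (Complex.I / 4) *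
      ((s ^ 2 * t ^ 2 * e' * he + 2 * t ^ 2 * e' * hs) * (b' * f2) -
        (s ^ 2 * t ^ 2 * e * he + 2 * s ^ 2 * e * ht) * (b1 * f1) +
        (s * t * (t ^ 2 + s ^ 2) * he + s * t * (hs + ht)) * ((a - a2) * f0))

end SplitStep
-- Translation invariant operators and their factorization
theorem EllTwo.add_apply (f g : EllTwo) (x : ℤ) : (f + g) x = f x + g x := rfl

theorem EllTwo.sub_apply (f g : EllTwo) (x : ℤ) : (f - g) x = f x - g x := rfl

theorem EllTwo.smul_apply (c : ℂ) (f : EllTwo) (x : ℤ) : (c • f) x = c * f x := rfl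

theorem norm_leftShift (f : EllTwo) : ‖leftShift f‖ = ‖f‖ := by
  have h : ‖leftShift‖ ≤ 1 := LinearMap.mkContinuous_norm_le _ zero_le_one _
  have h' : ‖rightShift‖ ≤ 1 := by
    rwa [rightShift, LinearIsometryEquiv.norm_map]
  refine le_antisymm (by simpa using leftShift.le_of_opNorm_le h f) ?_
  simpa [rightShift_leftShift] using rightShift.le_of_opNorm_le h' (leftShift f)

theorem norm_rightShift (f : EllTwo) : ‖rightShift f‖ = ‖f‖ := by
  rw [← norm_leftShift, leftShift_rightShift]

theorem norm_le_mul_of_forall {f g : EllTwo} {K : ℝ} (hK : 0 ≤ K)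
    (h : ∀ x, ‖f x‖ ≤ K * ‖g x‖) : ‖f‖ ≤ K * ‖g‖ := by
  have h' : ‖f‖ ≤ ‖(K : ℂ) • g‖ := by
    refine lp.norm_mono two_ne_zero fun x => (h x).trans_eq ?_
    rw [EllTwo.smul_apply, norm_mul, Complex.norm_real, Real.norm_eq_abs, abs_of_nonneg hK]
  rwa [norm_smul, Complex.norm_real, Real.norm_eq_abs, abs_of_nonneg hK] at h'

/-- The pointwise modulus of an `ℓ²` sequence. -/
noncomputable def modulus (f : EllTwo) : EllTwo :=
  ⟨fun x => (‖f x‖ : ℂ), (lp.memℓp f).mono' fun x => by simp⟩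

theorem modulus_apply (f : EllTwo) (x : ℤ) : modulus f x = (‖f x‖ : ℂ) := rfl

theorem norm_modulus (f : EllTwo) : ‖modulus f‖ = ‖f‖ :=
  le_antisymm (lp.norm_mono two_ne_zero fun x => by simp [modulus_apply])
    (lp.norm_mono two_ne_zero fun x => by simp [modulus_apply])

/-- The translation invariant operator `u L + v + w L*`. -/
noncomputable def laurentOp (u v w : ℂ) : EllTwo →L[ℂ] EllTwo :=
  u • leftShift + v • ContinuousLinearMap.id ℂ EllTwo + w • rightShift

theorem laurentOp_apply (u v w : ℂ) (f : EllTwo) (x : ℤ) :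
    laurentOp u v w f x = u * f (x + 1) + v * f x + w * f (x - 1) := by
  rw [← rightShift_apply]
  rfl

/-- Since L*L = 1, the operator splits into first-order factors, which can be estimated one at a
time. -/
theorem laurentOp_mul_eq (α β γ δ : ℂ) (f : EllTwo) :
    laurentOp (α * γ) (α * δ + β * γ) (β * δ) f =
      γ • (α • leftShift f + β • f) + δ • rightShift (α • leftShift f + β • f) := by
  ext x
  simp only [laurentOp_apply, rightShift_apply, EllTwo.add_apply, EllTwo.smul_apply, leftShift_apply,
    sub_add_cancel]
  ring

theorem abs_norm_sub_mul_norm_le (α β : ℂ) {f g h : EllTwo} (hg : ‖g‖ = ‖h‖) (hf : ‖f‖ = ‖h‖) :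
    |‖α‖ - ‖β‖| * ‖h‖ ≤ ‖α • f + β • g‖ := by
  have h1 := abs_norm_sub_norm_le (α • f) (-(β • g))
  rwa [sub_neg_eq_add, norm_neg, norm_smul, norm_smul, hg, hf, ← sub_mul, abs_mul, abs_norm] at h1

/-- Each factor is bounded below by the reverse triangle inequality, because L and L* are
isometries. -/
theorem le_norm_laurentOp (α β γ δ : ℂ) (f : EllTwo) :
    |‖γ‖ - ‖δ‖| * |‖α‖ - ‖β‖| * ‖f‖ ≤ ‖laurentOp (α * γ) (α * δ + β * γ) (β * δ) f‖ := by
  rw [laurentOp_mul_eq, mul_assoc]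
  refine le_trans ?_ (abs_norm_sub_mul_norm_le γ δ (norm_rightShift _) rfl)
  gcongr
  exact abs_norm_sub_mul_norm_le α β rfl (norm_leftShift _)

theorem norm_laurentOp_le (α β γ δ : ℂ) (f : EllTwo) :
    ‖laurentOp (α * γ) (α * δ + β * γ) (β * δ) f‖ ≤
      (‖γ‖ + ‖δ‖) * ‖α • leftShift f + β • f‖ := by
  rw [laurentOp_mul_eq]
  refine (norm_add_le _ _).trans_eq ?_
  rw [norm_smul, norm_smul, norm_rightShift]
  ring

/-! ### Sequences with prescribed support -/

/-- The subspace of sequences supported in `S`. -/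
def supportedIn (S : Set ℤ) : Submodule ℂ EllTwo where
  carrier := {f | ∀ x ∉ S, f x = 0}
  zero_mem' := fun _ _ => rfl
  add_mem' := fun hf hg x hx => by simp [hf x hx, hg x hx]
  smul_mem' := fun c f hf x hx => by simp [hf x hx]

open Classical in
/-- The projection onto the sequences supported in `S`. -/
noncomputable def restrictTo (S : Set ℤ) : EllTwo →L[ℂ] EllTwo :=
  mulOp (fun x => if x ∈ S then 1 else 0) fun x => by split_ifs <;> simp

theorem restrictTo_apply_of_mem {S : Set ℤ} {x : ℤ} (hx : x ∈ S) (f : EllTwo) :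
    restrictTo S f x = f x := by
  simp [restrictTo, hx]

theorem restrictTo_apply_of_notMem {S : Set ℤ} {x : ℤ} (hx : x ∉ S) (f : EllTwo) :
    restrictTo S f x = 0 := by
  simp [restrictTo, hx]

theorem restrictTo_mem (S : Set ℤ) (f : EllTwo) : restrictTo S f ∈ supportedIn S :=
  fun _ hx => restrictTo_apply_of_notMem hx f

theorem restrictTo_eq_self {S : Set ℤ} {f : EllTwo} (hf : f ∈ supportedIn S) :
    restrictTo S f = f := by
  ext x
  by_cases hx : x ∈ S
  · exact restrictTo_apply_of_mem hx f
  · rw [restrictTo_apply_of_notMem hx, hf x hx]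

theorem restrictTo_eq_zero {S S' : Set ℤ} (h : Disjoint S S') {f : EllTwo}
    (hf : f ∈ supportedIn S') : restrictTo S f = 0 := by
  ext x
  by_cases hx : x ∈ S
  · rw [restrictTo_apply_of_mem hx, hf x (Set.disjoint_left.mp h hx)]
    rfl
  · exact restrictTo_apply_of_notMem hx f

theorem isClosed_supportedIn (S : Set ℤ) : IsClosed (supportedIn S : Set EllTwo) := by
  have h : (supportedIn S : Set EllTwo) = {f | restrictTo S f = f} := by
    ext f
    exact ⟨restrictTo_eq_self, fun hf => hf ▸ restrictTo_mem S f⟩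
  rw [h]
  exact isClosed_eq (restrictTo S).continuous continuous_id

theorem supportedIn_finite {S : Set ℤ} (hS : S.Finite) :
    FiniteDimensional ℂ (supportedIn S) := by
  have : Finite S := hS
  let φ : supportedIn S →ₗ[ℂ] (S → ℂ) :=
    { toFun := fun f x => f.1 x
      map_add' := fun _ _ => rfl
      map_smul' := fun _ _ => rfl }
  refine FiniteDimensional.of_injective φ fun f g h => ?_
  ext x
  by_cases hx : x ∈ S
  · exact congrFun h ⟨x, hx⟩
  · rw [f.2 x hx, g.2 x hx]

/-- A map that is bounded below on a complete subspace has closed image. -/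
theorem isClosed_map_supportedIn {T : EllTwo →L[ℂ] EllTwo} {S : Set ℤ} {c : ℝ} (hc : 0 < c)
    (h : ∀ f ∈ supportedIn S, c * ‖f‖ ≤ ‖T f‖) :
    IsClosed ((supportedIn S).map T.toLinearMap : Set EllTwo) := by
  have : CompleteSpace (supportedIn S) := (isClosed_supportedIn S).completeSpace_coe
  let T' := T ∘L (supportedIn S).subtypeL
  have hT' : AntilipschitzWith ⟨c⁻¹, by positivity⟩ T' :=
    AddMonoidHomClass.antilipschitz_of_bound T' fun f => by
      have := h f f.2
      rw [← le_div_iff₀' hc, div_eq_inv_mul] at this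
      exact this
  have := hT'.isClosed_range T'.uniformContinuous
  convert this using 1
  ext y
  simp [T']

/-! ### Three-term operators: perturbation and gluing of the ends -/

/-- `T` acts as `(T f)(x) = u(x) f(x + 1) + v(x) f(x) + w(x) f(x - 1)`. -/
def IsJacobi (T : EllTwo →L[ℂ] EllTwo) (u v w : ℤ → ℂ) : Prop :=
  ∀ f x, T f x = u x * f (x + 1) + v x * f x + w x * f (x - 1)

namespace IsJacobi

variable {T : EllTwo →L[ℂ] EllTwo} {u v w : ℤ → ℂ}

/-- The coefficients multiplying the value f(y) are u(y - 1), v(y) and w(y + 1), so for f supported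
in S only these columns, with y in S, need to be close to the constants. -/
theorem norm_sub_laurentOp_le (hT : IsJacobi T u v w) {S : Set ℤ} {u₀ v₀ w₀ : ℂ} {ε : ℝ}
    (hε : 0 ≤ ε) (h : ∀ x ∈ S, ‖u (x - 1) - u₀‖ ≤ ε ∧ ‖v x - v₀‖ ≤ ε ∧ ‖w (x + 1) - w₀‖ ≤ ε)
    {f : EllTwo} (hf : f ∈ supportedIn S) : ‖T f - laurentOp u₀ v₀ w₀ f‖ ≤ ε * (3 * ‖f‖) := by
  have key : ∀ (z : ℂ) (x : ℤ), (x ∈ S → ‖z‖ ≤ ε) → ‖z * f x‖ ≤ ε * ‖f x‖ := fun z x hz => by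
    by_cases hx : x ∈ S
    · rw [norm_mul]
      gcongr
      exact hz hx
    · simp [hf x hx]
  -- The error at x is at most ε(|f(x+1)| + |f(x)| + |f(x-1)|), which is ε times this g; its three
  -- terms give the factor 3.
  let g := laurentOp 1 1 1 (modulus f)
  have hg : ‖g‖ ≤ 3 * ‖f‖ := by
    simp only [g, laurentOp, one_smul]
    refine (norm_add₃_le).trans_eq ?_
    have h1 := norm_leftShift (modulus f)
    have h2 := norm_rightShift (modulus f)
    have h3 := norm_modulus f
    simp only [ContinuousLinearMap.coe_coe, ContinuousLinearMap.id_apply]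
    linarith
  refine le_trans (norm_le_mul_of_forall hε fun x => ?_) (mul_le_mul_of_nonneg_left hg hε)
  have e1 : (T f - laurentOp u₀ v₀ w₀ f) x =
      (u x - u₀) * f (x + 1) + (v x - v₀) * f x + (w x - w₀) * f (x - 1) := by
    rw [EllTwo.sub_apply, hT, laurentOp_apply]
    ring
  have e2 : ‖g x‖ = ‖f (x + 1)‖ + ‖f x‖ + ‖f (x - 1)‖ := by
    simp only [g, laurentOp_apply, modulus_apply, one_mul, ← Complex.ofReal_add,
      Complex.norm_real, Real.norm_eq_abs]
    exact abs_of_nonneg (by positivity)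
  rw [e1, e2, mul_add, mul_add]
  refine norm_add₃_le.trans (add_le_add_three (key _ _ fun hx => ?_) (key _ _ fun hx => ?_)
    (key _ _ fun hx => ?_))
  · simpa using (h _ hx).1
  · exact (h _ hx).2.1
  · simpa using (h _ hx).2.2

/-- The perturbation costs three times one sixth of the lower bound of the limit operator, so half
of that bound survives. -/
theorem le_norm_of_near (hT : IsJacobi T u v w) {S : Set ℤ} {α β γ δ : ℂ}
    (h : ∀ x ∈ S, ‖u (x - 1) - α * γ‖ ≤ |‖γ‖ - ‖δ‖| * |‖α‖ - ‖β‖| / 6 ∧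
      ‖v x - (α * δ + β * γ)‖ ≤ |‖γ‖ - ‖δ‖| * |‖α‖ - ‖β‖| / 6 ∧
      ‖w (x + 1) - β * δ‖ ≤ |‖γ‖ - ‖δ‖| * |‖α‖ - ‖β‖| / 6)
    {f : EllTwo} (hf : f ∈ supportedIn S) :
    |‖γ‖ - ‖δ‖| * |‖α‖ - ‖β‖| / 2 * ‖f‖ ≤ ‖T f‖ := by
  have h1 := hT.norm_sub_laurentOp_le (by positivity) h hf
  have h2 := le_norm_laurentOp α β γ δ f
  have h3 := norm_sub_norm_le (laurentOp (α * γ) (α * δ + β * γ) (β * δ) f) (T f)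
  rw [norm_sub_rev] at h3
  linarith

theorem map_mem_supportedIn (hT : IsJacobi T u v w) {S S' : Set ℤ}
    (h : ∀ x, x + 1 ∈ S ∨ x ∈ S ∨ x - 1 ∈ S → x ∈ S') {f : EllTwo} (hf : f ∈ supportedIn S) :
    T f ∈ supportedIn S' := fun x hx => by
  have := mt (h x) hx
  push Not at this
  rw [hT, hf _ this.1, hf _ this.2.1, hf _ this.2.2]
  ring

/-- The operator widens supports by one site, so the gap keeps the images of the two ends disjointly
supported. Their sum is then closed, and the sites in between add only a finite-dimensional space.
-/
theorem isClosed_range (hT : IsJacobi T u v w) {M N : ℤ} (hMN : M + 2 < N)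
    (hM : IsClosed ((supportedIn (Set.Iic M)).map T.toLinearMap : Set EllTwo))
    (hN : IsClosed ((supportedIn (Set.Ici N)).map T.toLinearMap : Set EllTwo)) :
    IsClosed (Set.range T) := by
  set A := (supportedIn (Set.Iic M)).map T.toLinearMap with hA
  set B := (supportedIn (Set.Ici N)).map T.toLinearMap with hB
  have hAs : A ≤ supportedIn (Set.Iic (M + 1)) := by
    rintro _ ⟨f, hf, rfl⟩
    exact hT.map_mem_supportedIn (fun x hx => by simp only [Set.mem_Iic] at *; lia) hf
  have hBs : B ≤ supportedIn (Set.Ici (N - 1)) := by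
    rintro _ ⟨f, hf, rfl⟩
    exact hT.map_mem_supportedIn (fun x hx => by simp only [Set.mem_Ici] at *; lia) hf
  have hd : Disjoint (Set.Iic (M + 1)) (Set.Ici (N - 1)) :=
    Set.disjoint_left.mpr fun x hx hx' => by simp only [Set.mem_Iic, Set.mem_Ici] at *; lia
  have hAB : IsClosed ((A ⊔ B : Submodule ℂ EllTwo) : Set EllTwo) := by
    -- Disjoint supports let membership in the sum be tested on each restriction separately, which
    -- is a closed condition.
    have : ((A ⊔ B : Submodule ℂ EllTwo) : Set EllTwo) =
        restrictTo (Set.Iic (M + 1)) ⁻¹' A ∩ restrictTo (Set.Ici (N - 1)) ⁻¹' B ∩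
          {f | restrictTo (Set.Iic (M + 1)) f + restrictTo (Set.Ici (N - 1)) f = f} := by
      ext f
      constructor
      · intro hf
        obtain ⟨g, hg, h, hh, rfl⟩ := Submodule.mem_sup.mp hf
        have e1 : restrictTo (Set.Iic (M + 1)) (g + h) = g := by
          rw [map_add, restrictTo_eq_self (hAs hg), restrictTo_eq_zero hd (hBs hh), add_zero]
        have e2 : restrictTo (Set.Ici (N - 1)) (g + h) = h := by
          rw [map_add, restrictTo_eq_self (hBs hh), restrictTo_eq_zero hd.symm (hAs hg), zero_add]
        refine ⟨⟨?_, ?_⟩, ?_⟩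
        · rwa [Set.mem_preimage, e1]
        · rwa [Set.mem_preimage, e2]
        · rw [Set.mem_ofPred_eq, e1, e2]
      · rintro ⟨⟨h1, h2⟩, h3⟩
        rw [← h3.out]
        exact Submodule.add_mem_sup h1 h2
    rw [this]
    exact ((hM.preimage (restrictTo _).continuous).inter
      (hN.preimage (restrictTo _).continuous)).inter
      (isClosed_eq ((restrictTo _).continuous.add (restrictTo _).continuous) continuous_id)
  have hfin : FiniteDimensional ℂ (supportedIn (Set.Ioo M N)) :=
    supportedIn_finite (Set.finite_Ioo M N)
  have htop : supportedIn (Set.Iic M) ⊔ supportedIn (Set.Ici N) ⊔ supportedIn (Set.Ioo M N) = ⊤ := by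
    rw [eq_top_iff]
    intro f _
    have : f = restrictTo (Set.Iic M) f + restrictTo (Set.Ici N) f +
        restrictTo (Set.Ioo M N) f := by
      ext x
      rcases le_or_gt x M with h1 | h1
      · have h2 : x < N := by lia
        simp [restrictTo, h1, h1.not_gt, h2.not_ge]
      · rcases le_or_gt N x with h2 | h2
        · simp [restrictTo, h1.not_ge, h2, h2.not_gt]
        · simp [restrictTo, h1, h1.not_ge, h2, h2.not_ge]
    rw [this]
    exact Submodule.add_mem_sup (Submodule.add_mem_sup (restrictTo_mem _ _) (restrictTo_mem _ _))
      (restrictTo_mem _ _)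
  have := Submodule.isClosed_sup_finiteDimensional (A ⊔ B)
    ((supportedIn (Set.Ioo M N)).map T.toLinearMap) hAB
  rw [hA, hB, ← Submodule.map_sup, ← Submodule.map_sup, htop, Submodule.map_top] at this
  exact this

end IsJacobi
-- Approximate kernel vectors and failure of closedness
/-- The plane wave `x ↦ z ^ x`, cut off to the interval `[M, M + n)`. -/
noncomputable def planeWave (z : ℂ) (M : ℤ) (n : ℕ) : EllTwo :=
  ∑ x ∈ Finset.Ico M (M + n), lp.single 2 x (z ^ x)

theorem planeWave_apply (z : ℂ) (M : ℤ) (n : ℕ) (x : ℤ) :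
    planeWave z M n x = if M ≤ x ∧ x < M + n then z ^ x else 0 := by
  rw [planeWave, lp.coeFn_sum]
  simp [Finset.sum_apply, Pi.single_apply]

theorem planeWave_mem (z : ℂ) (M : ℤ) (n : ℕ) :
    planeWave z M n ∈ supportedIn (Set.Ico M (M + n)) := fun x hx => by
  rw [planeWave_apply, if_neg (by simpa using hx)]

theorem norm_planeWave {z : ℂ} (hz : ‖z‖ = 1) (M : ℤ) (n : ℕ) : ‖planeWave z M n‖ = √n := by
  have h := lp.norm_sum_single (E := fun _ : ℤ => ℂ) (p := 2) (by norm_num) (fun x => z ^ x)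
    (Finset.Ico M (M + n))
  simp only [ENNReal.toReal_ofNat, Real.rpow_ofNat, norm_zpow, hz, one_zpow, one_pow,
    Finset.sum_const, Int.card_Ico, add_sub_cancel_left, Int.toNat_natCast, nsmul_eq_mul,
    mul_one] at h
  rw [← h, planeWave, Real.sqrt_sq (norm_nonneg _)]

/-- The untruncated wave is annihilated by αL + β, so only the two cut-off sites contribute,
whatever the length. -/
theorem norm_shift_planeWave_le {α β z : ℂ} (hz : ‖z‖ = 1) (h : α * z + β = 0) (M : ℤ) (n : ℕ) :
    ‖α • leftShift (planeWave z M n) + β • planeWave z M n‖ ≤ 2 * ‖α‖ := by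
  have hz0 : z ≠ 0 := norm_ne_zero_iff.mp (by rw [hz]; exact one_ne_zero)
  have key : α • leftShift (planeWave z M n) + β • planeWave z M n =
      α • (lp.single 2 (M - 1) (z ^ M) - lp.single 2 (M + n - 1) (z ^ (M + n)) : EllTwo) := by
    obtain rfl : β = -(α * z) := by linear_combination h
    ext x
    simp only [EllTwo.add_apply, EllTwo.smul_apply, EllTwo.sub_apply, leftShift_apply,
      planeWave_apply, lp.single_apply, Pi.single_apply]
    have hzx : z ^ (x + 1) = z * z ^ x := by rw [zpow_add_one₀ hz0, mul_comm]
    -- For n = 0 the two boundary terms sit at the same site and cancel; otherwise they are at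
    -- distinct sites.
    rcases n.eq_zero_or_pos with rfl | hn
    · have h1 : ¬ (M ≤ x + 1 ∧ x + 1 < M + (0 : ℕ)) := by lia
      have h2 : ¬ (M ≤ x ∧ x < M + (0 : ℕ)) := by lia
      rw [if_neg h1, if_neg h2]
      simp
    · by_cases h1 : x = M - 1
      · have h2 : M ≤ x + 1 ∧ x + 1 < M + n := by lia
        have h3 : ¬ (M ≤ x ∧ x < M + n) := by lia
        have h4 : ¬ x = M + n - 1 := by lia
        rw [if_pos h1, if_pos h2, if_neg h3, if_neg h4, h1, sub_add_cancel]
        ring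
      · by_cases h2 : x = M + n - 1
        · have h3 : ¬ (M ≤ x + 1 ∧ x + 1 < M + n) := by lia
          have h4 : M ≤ x ∧ x < M + n := by lia
          have h5 : M + n = x + 1 := by lia
          rw [if_neg h1, if_neg h3, if_pos h4, if_pos h2, h5, hzx]
          ring
        · have h3 : (M ≤ x + 1 ∧ x + 1 < M + n) ↔ (M ≤ x ∧ x < M + n) := by lia
          rw [if_neg h1, if_neg h2]
          simp only [h3]
          split_ifs
          · rw [hzx]
            ring
          · ring
  rw [key, norm_smul, mul_comm]
  gcongr
  refine (norm_sub_le _ _).trans_eq ?_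
  rw [lp.norm_single (by norm_num), lp.norm_single (by norm_num), norm_zpow, norm_zpow, hz,
    one_zpow, one_zpow]
  norm_num

theorem exists_ne_zero_of_two_functionals (a b : Fin 3 → ℂ) :
    ∃ c : Fin 3 → ℂ, c ≠ 0 ∧ ∑ i, c i * a i = 0 ∧ ∑ i, c i * b i = 0 := by
  let φ : (Fin 3 → ℂ) →ₗ[ℂ] (Fin 2 → ℂ) := Matrix.mulVecLin !![a 0, a 1, a 2; b 0, b 1, b 2]
  have h : LinearMap.ker φ ≠ ⊥ := LinearMap.ker_ne_bot_of_finrank_lt (by simp)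
  obtain ⟨c, hc, hc0⟩ := Submodule.exists_mem_ne_zero_of_ne_bot h
  refine ⟨c, hc0, ?_, ?_⟩
  · have := congrFun (LinearMap.mem_ker.mp hc) 0
    simp [φ, Matrix.mulVec, dotProduct, Fin.sum_univ_three] at this
    rw [Fin.sum_univ_three]
    linear_combination this
  · have := congrFun (LinearMap.mem_ker.mp hc) 1
    simp [φ, Matrix.mulVec, dotProduct, Fin.sum_univ_three] at this
    rw [Fin.sum_univ_three]
    linear_combination this

/-- If kernel vectors are determined on `S` by their values at two sites, then `T` with closed
range cannot have three disjointly supported approximate kernel vectors in `S`. -/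
theorem not_isClosed_range_of_approx_kernel {T : EllTwo →L[ℂ] EllTwo} {S : Set ℤ} {x₀ x₁ : ℤ}
    (huniq : ∀ f, T f = 0 → f x₀ = 0 → f x₁ = 0 → ∀ x ∈ S, f x = 0)
    (happrox : ∀ ε > 0, ∃ (φ : Fin 3 → EllTwo) (I : Fin 3 → Set ℤ),
      (∀ i, I i ⊆ S ∧ φ i ∈ supportedIn (I i) ∧ ‖T (φ i)‖ < ε * ‖φ i‖) ∧
      (∀ i j, ‖φ i‖ = ‖φ j‖) ∧ ∀ i j, i ≠ j → Disjoint (I i) (I j)) :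
    ¬ IsClosed (Set.range T) := by
  intro hcl
  have : CompleteSpace T.range := IsClosed.completeSpace_coe (s := Set.range T) (hs := hcl)
  -- Open mapping onto the closed range: each T(φ i) has a preimage χ i of comparable norm, so φ i -
  -- χ i lies in the kernel.
  obtain ⟨C, hC, hpre⟩ := T.rangeRestrict.exists_preimage_norm_le
    (LinearMap.surjective_rangeRestrict T.toLinearMap)
  obtain ⟨φ, I, h, hnorm, hdisj⟩ := happrox (1 / (3 * C)) (by positivity)
  have hχ : ∀ i, ∃ χ, T χ = T (φ i) ∧ ‖χ‖ ≤ C * ‖T (φ i)‖ := fun i => by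
    obtain ⟨χ, h1, h2⟩ := hpre ⟨T (φ i), φ i, rfl⟩
    exact ⟨χ, congrArg Subtype.val h1, h2⟩
  choose χ hTχ hχn using hχ
  -- Three kernel vectors against two evaluations: some nontrivial combination vanishes at both
  -- sites, hence on S.
  obtain ⟨c, hc0, hc1, hc2⟩ := exists_ne_zero_of_two_functionals
    (fun i => φ i x₀ - χ i x₀) (fun i => φ i x₁ - χ i x₁)
  have happ : ∀ x, (∑ i, c i • (φ i - χ i) : EllTwo) x = ∑ i, c i * (φ i x - χ i x) := fun x => by
    rw [Fin.sum_univ_three, Fin.sum_univ_three]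
    rfl
  have hzero := huniq (∑ i, c i • (φ i - χ i)) (by simp [map_sum, hTχ]) ((happ _).trans hc1)
    ((happ _).trans hc2)
  -- On the support of φ i, with |c i| maximal, c i φ i equals the combination of the χ j. Each χ j
  -- has norm below ‖φ i‖/3, which is contradictory.
  obtain ⟨i, -, hi⟩ := Finset.exists_max_image Finset.univ (fun i => ‖c i‖) Finset.univ_nonempty
  have hci : 0 < ‖c i‖ := by
    obtain ⟨j, hj⟩ := Function.ne_iff.mp hc0
    exact (norm_pos_iff.mpr hj).trans_le (hi j (Finset.mem_univ j))
  have h1 : ‖c i • φ i‖ ≤ ‖∑ j, c j • χ j‖ := by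
    refine lp.norm_mono two_ne_zero fun x => ?_
    by_cases hx : x ∈ I i
    · have h2 := (happ x).symm.trans (hzero x ((h i).1 hx))
      have h3 : ∑ j, c j * φ j x = c i * φ i x :=
        Finset.sum_eq_single i (fun j _ hj => by
          rw [(h j).2.1 x (Set.disjoint_right.mp (hdisj j i hj) hx), mul_zero]) (by simp)
      have h4 : (∑ j, c j • χ j : EllTwo) x = ∑ j, c j * χ j x := by
        rw [Fin.sum_univ_three, Fin.sum_univ_three]
        rfl
      simp only [mul_sub, Finset.sum_sub_distrib, h3, sub_eq_zero] at h2
      rw [h4, EllTwo.smul_apply, h2]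
    · rw [EllTwo.smul_apply, (h i).2.1 x hx, mul_zero, norm_zero]
      exact norm_nonneg _
  have hφ : ∀ j, ‖χ j‖ < ‖φ i‖ / 3 := fun j => by
    have h5 := mul_lt_mul_of_pos_left (h j).2.2 hC
    have h6 : C * (1 / (3 * C) * ‖φ j‖) = ‖φ j‖ / 3 := by field_simp
    rw [h6, hnorm j i] at h5
    exact (hχn j).trans_lt h5
  have h7 : ‖∑ j, c j • χ j‖ < ‖c i‖ * ‖φ i‖ := by
    refine (norm_sum_le _ _).trans_lt ?_
    have h8 : ∀ j, ‖c j • χ j‖ < ‖c i‖ * (‖φ i‖ / 3) := fun j => by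
      rw [norm_smul]
      exact (mul_le_mul_of_nonneg_right (hi j (Finset.mem_univ j)) (norm_nonneg _)).trans_lt
        (mul_lt_mul_of_pos_left (hφ j) hci)
    rw [Fin.sum_univ_three]
    linarith [h8 0, h8 1, h8 2]
  rw [norm_smul] at h1
  exact absurd h1 h7.not_ge

namespace IsJacobi

variable {T : EllTwo →L[ℂ] EllTwo} {u v w : ℤ → ℂ}

theorem not_isClosed_range (hT : IsJacobi T u v w) {S : Set ℤ} {x₀ x₁ : ℤ}
    (huniq : ∀ f, T f = 0 → f x₀ = 0 → f x₁ = 0 → ∀ x ∈ S, f x = 0)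
    {α β γ δ : ℂ} (hα : α ≠ 0) (hαβ : ‖α‖ = ‖β‖)
    (hlim : ∀ ε > 0, ∀ n : ℕ, ∃ M : ℤ, ∀ x ∈ Set.Ico M (M + n), x ∈ S ∧
      ‖u (x - 1) - α * γ‖ ≤ ε ∧ ‖v x - (α * δ + β * γ)‖ ≤ ε ∧ ‖w (x + 1) - β * δ‖ ≤ ε) :
    ¬ IsClosed (Set.range T) := by
  refine not_isClosed_range_of_approx_kernel huniq fun ε hε => ?_
  set K := (‖γ‖ + ‖δ‖) * (2 * ‖α‖)
  obtain ⟨n, hn⟩ := exists_nat_gt ((2 * K / ε) ^ 2)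
  have hn' : 2 * K / ε < √n := Real.lt_sqrt_of_sq_lt hn
  have hKn : K < ε / 2 * √n := by
    rw [div_lt_iff₀ hε] at hn'
    linarith
  -- The perturbation costs 3 · ε/6 = ε/2 relative to the wave, and the boundary terms cost less
  -- than the other ε/2. The length 3n leaves room for three disjoint windows.
  obtain ⟨M, hM⟩ := hlim (ε / 6) (by positivity) (3 * n)
  set z := -(β / α)
  have hz : ‖z‖ = 1 := by
    rw [norm_neg, norm_div, ← hαβ, div_self (norm_ne_zero_iff.mpr hα)]
  have hz' : α * z + β = 0 := by
    simp only [z]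
    field_simp
    ring
  have hsub : ∀ i : Fin 3, Set.Ico (M + i.val * n) (M + i.val * n + n) ⊆
      Set.Ico M (M + (3 * n : ℕ)) := fun i => by
    intro x hx
    simp only [Set.mem_Ico] at hx ⊢
    fin_cases i <;> simp at hx <;> lia
  refine ⟨fun i => planeWave z (M + i.val * n) n,
    fun i => Set.Ico (M + i.val * n) (M + i.val * n + n), fun i => ⟨fun x hx => (hM x (hsub i hx)).1,
      planeWave_mem _ _ _, ?_⟩, fun i j => ?_, fun i j hij => ?_⟩
  · have h1 := hT.norm_sub_laurentOp_le (by positivity) (fun x hx => (hM x (hsub i hx)).2)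
      (planeWave_mem z (M + i.val * n) n)
    have h2 := (norm_laurentOp_le α β γ δ (planeWave z (M + i.val * n) n)).trans
      (mul_le_mul_of_nonneg_left (norm_shift_planeWave_le hz hz' (M + i.val * n) n)
        (by positivity))
    have h3 := norm_sub_norm_le (T (planeWave z (M + i.val * n) n))
      (laurentOp (α * γ) (α * δ + β * γ) (β * δ) (planeWave z (M + i.val * n) n))
    rw [norm_planeWave hz] at h1 ⊢
    linarith
  · rw [norm_planeWave hz, norm_planeWave hz]
  · refine Set.disjoint_left.mpr fun x hx hx' => ?_
    simp only [Set.mem_Ico] at hx hx'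
    fin_cases i <;> fin_cases j <;> simp at hij hx hx' <;> lia

end IsJacobi
-- Limits of the coefficients and factorization of the symbol
-- For the points (p, s) and (a, r) of the open upper unit semicircle, s/(1 + p) and r/(1 + a) are
-- the tangents of the half angles, which determine the points.
theorem one_add_mul_eq_mul_one_add_iff {p s a r : ℝ} (hs : 0 < s) (hr : 0 < r)
    (hps : p ^ 2 + s ^ 2 = 1) (har : a ^ 2 + r ^ 2 = 1) : (1 + p) * r = s * (1 + a) ↔ p = a := by
  constructor
  · intro h
    have hp : 0 < 1 + p := by nlinarith
    have ha : 0 < 1 + a := by nlinarith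
    have h2 : (1 + p) * (1 + a) * (2 * (p - a)) = 0 := by
      linear_combination ((1 + p) * r + s * (1 + a)) * h - (1 + p) ^ 2 * har + (1 + a) ^ 2 * hps
    have := (mul_eq_zero.mp h2).resolve_left (mul_pos hp ha).ne'
    linarith
  · rintro rfl
    have : r = s := by
      rw [← abs_of_pos hr, ← abs_of_pos hs, ← sq_eq_sq_iff_abs_eq_abs]
      linarith
    rw [this, mul_comm]

namespace SplitStep

variable (W : SplitStep)

/-- The coefficient of `L` in `Q_{ε₊}`. -/
noncomputable def coeffU (x : ℤ) : ℂ :=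
  (Complex.I / 2) * ((1 + W.p) * Complex.exp (Complex.I * (W.q.arg : ℂ)) * W.b (x + 1))

/-- The diagonal coefficient of `Q_{ε₊}`. -/
noncomputable def coeffV (x : ℤ) : ℂ := (Complex.I / 2) * (‖W.q‖ * (W.a₂ (x + 1) - W.a₁ x))

/-- The coefficient of `L*` in `Q_{ε₊}`. -/
noncomputable def coeffW (x : ℤ) : ℂ :=
  -((Complex.I / 2) * ((1 - W.p) * Complex.exp (-(Complex.I * (W.q.arg : ℂ))) * conj (W.b x)))

theorem isJacobi : IsJacobi W.QepsPlus W.coeffU W.coeffV W.coeffW := fun f x => by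
  rw [QepsPlus_apply, coeffU, coeffV, coeffW]
  ring

theorem coeffU_ne_zero {x : ℤ} (h : W.b (x + 1) ≠ 0) : W.coeffU x ≠ 0 := by
  have hp : (1 + W.p : ℂ) ≠ 0 := by
    exact_mod_cast (by linarith [(abs_lt.mp W.abs_p_lt_one).1] : (0 : ℝ) < 1 + W.p).ne'
  simp [coeffU, hp, h]

theorem coeffW_ne_zero {x : ℤ} (h : W.b x ≠ 0) : W.coeffW x ≠ 0 := by
  have hp : (1 - W.p : ℂ) ≠ 0 := by
    exact_mod_cast (by linarith [(abs_lt.mp W.abs_p_lt_one).2] : (0 : ℝ) < 1 - W.p).ne'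
  simp [coeffW, hp, h]

/-- The coefficients of `Q_{ε₊}` converge along `l`, in the alignment of the columns, to those of
`(α L + β) (γ + δ L*)`. -/
def HasFactoredLimit (l : Filter ℤ) (α β γ δ : ℂ) : Prop :=
  Tendsto (fun x => W.coeffU (x - 1)) l (𝓝 (α * γ)) ∧
    Tendsto W.coeffV l (𝓝 (α * δ + β * γ)) ∧
      Tendsto (fun x => W.coeffW (x + 1)) l (𝓝 (β * δ))

variable {W} in
theorem HasFactoredLimit.swap {l : Filter ℤ} {α β γ δ : ℂ} (h : W.HasFactoredLimit l α β γ δ) :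
    W.HasFactoredLimit l γ δ α β := by
  obtain ⟨h1, h2, h3⟩ := h
  refine ⟨?_, ?_, ?_⟩
  · rwa [mul_comm]
  · rwa [add_comm, mul_comm γ, mul_comm δ]
  · rwa [mul_comm]

variable {W} in
theorem HasFactoredLimit.eventually {l : Filter ℤ} {α β γ δ : ℂ}
    (h : W.HasFactoredLimit l α β γ δ) {ε : ℝ} (hε : 0 < ε) :
    ∀ᶠ x in l, ‖W.coeffU (x - 1) - α * γ‖ ≤ ε ∧ ‖W.coeffV x - (α * δ + β * γ)‖ ≤ ε ∧
      ‖W.coeffW (x + 1) - β * δ‖ ≤ ε := by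
  have key : ∀ {g : ℤ → ℂ} {y : ℂ}, Tendsto g l (𝓝 y) → ∀ᶠ x in l, ‖g x - y‖ ≤ ε := fun hg => by
    filter_upwards [Metric.tendsto_nhds.mp hg ε hε] with x hx
    rw [← dist_eq_norm]
    exact hx.le
  exact (key h.1).and ((key h.2.1).and (key h.2.2))

section Limit

variable {W} {l : Filter ℤ} {a a' : ℝ} {b : ℂ}

theorem hasFactoredLimit_of (hl : Tendsto (fun x : ℤ => x + 1) l l)
    (h1 : Tendsto W.a₁ l (𝓝 a)) (h2 : Tendsto W.a₂ l (𝓝 (-a))) (hb : Tendsto W.b l (𝓝 b))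
    {α β γ δ : ℂ}
    (e1 : α * γ = (Complex.I / 2) * ((1 + W.p) * Complex.exp (Complex.I * (W.q.arg : ℂ)) * b))
    (e2 : α * δ + β * γ = (Complex.I / 2) * (‖W.q‖ * (-a - a)))
    (e3 : β * δ =
      -((Complex.I / 2) * ((1 - W.p) * Complex.exp (-(Complex.I * (W.q.arg : ℂ))) * conj b))) :
    W.HasFactoredLimit l α β γ δ := by
  have h1' : Tendsto (fun x => (W.a₁ x : ℂ)) l (𝓝 a) := (Complex.continuous_ofReal.tendsto a).comp h1
  have h2' : Tendsto (fun x => (W.a₂ (x + 1) : ℂ)) l (𝓝 (-a)) := by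
    have := (Complex.continuous_ofReal.tendsto (-a)).comp (h2.comp hl)
    rwa [Complex.ofReal_neg] at this
  refine ⟨?_, ?_, ?_⟩
  · rw [e1]
    simp only [coeffU, sub_add_cancel]
    exact (hb.const_mul _).const_mul _
  · rw [e2]
    exact ((h2'.sub h1').const_mul _).const_mul _
  · rw [e3]
    exact ((((Complex.continuous_conj.tendsto b).comp (hb.comp hl)).const_mul _).const_mul _).neg

/-- The relation b(a₁ + a₂) = 0 forces b = 0 eventually. Then a₁ and a₂ take values ±1, and their
nonzero limiting sum makes the signs agree, so the coefficients vanish exactly and not only in the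
limit. -/
theorem eventually_coeff_eq_zero (hl : Tendsto (fun x : ℤ => x + 1) l l)
    (h1 : Tendsto W.a₁ l (𝓝 a)) (h2 : Tendsto W.a₂ l (𝓝 a')) (ha : a + a' ≠ 0) :
    ∀ᶠ x in l, W.coeffU (x - 1) = 0 ∧ W.coeffV x = 0 ∧ W.coeffW (x + 1) = 0 := by
  have hb : ∀ᶠ x in l, W.b x = 0 := by
    filter_upwards [(h1.add h2).eventually_ne ha] with x hx
    exact (mul_eq_zero.mp (W.coin_cond₃ x)).resolve_right (by exact_mod_cast hx)
  have hv : ∀ᶠ x in l, W.a₂ (x + 1) = W.a₁ x := by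
    have e1 : ∀ᶠ x in l, W.a₁ x ^ 2 = 1 := hb.mono fun x hx => by simpa [hx] using W.coin_cond₁ x
    have e2 : ∀ᶠ x in l, W.a₂ (x + 1) ^ 2 = 1 :=
      (hl.eventually hb).mono fun x hx => by simpa [hx] using W.coin_cond₂ (x + 1)
    filter_upwards [e1, e2, (h1.add (h2.comp hl)).eventually_ne ha] with x h3 h4 h5
    have h6 : (W.a₁ x + W.a₂ (x + 1)) * (W.a₂ (x + 1) - W.a₁ x) = 0 := by
      linear_combination h4 - h3
    linarith [(mul_eq_zero.mp h6).resolve_left h5]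
  filter_upwards [hb, hv, hl.eventually hb] with x h3 h4 h5
  simp [coeffU, coeffV, coeffW, h3, h4, h5]

/-- The limit symbol is i/2 times (1+p)e^{iθ}b z - 2|q|a - (1-p)e^{-iθ}b* z⁻¹. As a² + |b|² = 1 and
1 - p² = |q|², its zeros are the explicit numbers |q|(a ± 1)/((1+p)e^{iθ}b), and the half-angle
lemma tells when they have modulus one. -/
theorem exists_hasFactoredLimit (hl : Tendsto (fun x : ℤ => x + 1) l l)
    (h1 : Tendsto W.a₁ l (𝓝 a)) (h2 : Tendsto W.a₂ l (𝓝 (-a))) (hb : Tendsto W.b l (𝓝 b))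
    (hb0 : b ≠ 0) (hab : a ^ 2 + ‖b‖ ^ 2 = 1) :
    ∃ α β γ δ : ℂ, W.HasFactoredLimit l α β γ δ ∧ α ≠ 0 ∧ γ ≠ 0 ∧
      (‖α‖ = ‖β‖ ↔ W.p = a) ∧ (‖γ‖ = ‖δ‖ ↔ W.p = -a) := by
  obtain ⟨hp1, hp2⟩ := abs_lt.mp W.abs_p_lt_one
  have hp : (1 + W.p : ℂ) ≠ 0 := by
    exact_mod_cast (by linarith : (0 : ℝ) < 1 + W.p).ne'
  have hr : 0 < ‖b‖ := norm_pos_iff.mpr hb0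
  have hs : 0 < ‖W.q‖ := norm_pos_iff.mpr W.q_ne_zero
  have ha1 : 0 ≤ 1 + a := by nlinarith
  have ha2 : 0 ≤ 1 - a := by nlinarith
  have hb' : b * conj b = (1 - a ^ 2 : ℂ) := by
    rw [Complex.mul_conj, Complex.normSq_eq_norm_sq, eq_sub_of_add_eq' hab]
    push_cast
    ring
  have hq' : (‖W.q‖ : ℂ) ^ 2 = 1 - (W.p : ℂ) ^ 2 := by
    rw [← Complex.ofReal_pow, eq_sub_of_add_eq' W.shift_cond]
    push_cast
    ring
  have hne := Complex.exp_ne_zero (Complex.I * (W.q.arg : ℂ))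
  have hnorm : ‖Complex.exp (Complex.I * (W.q.arg : ℂ))‖ = 1 := by
    rw [mul_comm, Complex.norm_exp_ofReal_mul_I]
  have hnormp : ‖(1 + W.p : ℂ)‖ = 1 + W.p := by
    rw [← Complex.ofReal_one, ← Complex.ofReal_add, Complex.norm_real, Real.norm_eq_abs,
      abs_of_pos (by linarith)]
  have hnorma1 : ‖(1 + a : ℂ)‖ = 1 + a := by
    rw [← Complex.ofReal_one, ← Complex.ofReal_add, Complex.norm_real, Real.norm_eq_abs,
      abs_of_nonneg ha1]
  have hnorma2 : ‖(1 - a : ℂ)‖ = 1 - a := by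
    rw [← Complex.ofReal_one, ← Complex.ofReal_sub, Complex.norm_real, Real.norm_eq_abs,
      abs_of_nonneg ha2]
  refine ⟨(Complex.I / 2) * ((1 + W.p) * Complex.exp (Complex.I * (W.q.arg : ℂ)) * b),
    -((Complex.I / 2) * (‖W.q‖ * (1 + a))), 1,
    ‖W.q‖ * (1 - a) / ((1 + W.p) * Complex.exp (Complex.I * (W.q.arg : ℂ)) * b),
    hasFactoredLimit_of hl h1 h2 hb (mul_one _) ?_ ?_, ?_, one_ne_zero, ?_, ?_⟩
  · field_simp
    ring
  · rw [Complex.exp_neg]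
    field_simp
    linear_combination (a ^ 2 - 1) * hq' + (1 - (W.p : ℂ) ^ 2) * hb'
  · simp [hp, hb0]
  · rw [← one_add_mul_eq_mul_one_add_iff hs hr W.shift_cond hab]
    simp only [norm_neg, norm_mul, hnorm, hnormp, hnorma1, Complex.norm_real, norm_norm, mul_one]
    exact mul_right_inj' (by simp)
  · rw [← one_add_mul_eq_mul_one_add_iff hs hr W.shift_cond (by rwa [neg_sq])]
    simp only [norm_one, norm_div, norm_mul, hnorm, hnormp, hnorma2, Complex.norm_real, norm_norm,
      mul_one]
    rw [eq_div_iff (mul_pos (by linarith) hr).ne', one_mul, sub_eq_add_neg]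

theorem limit_trichotomy [l.NeBot] {C : Matrix (Fin 2) (Fin 2) ℂ}
    (hl : Tendsto (fun x : ℤ => x + 1) l l)
    (hC : Tendsto W.coinMatrix l (𝓝 C)) :
    ((¬ C.IsDiag → |W.p| ≠ |(C 0 0).re|) ∧
      ∀ᶠ x in l, W.coeffU (x - 1) = 0 ∧ W.coeffV x = 0 ∧ W.coeffW (x + 1) = 0) ∨
    ((¬ C.IsDiag → |W.p| ≠ |(C 0 0).re|) ∧
      ∃ α β γ δ : ℂ, W.HasFactoredLimit l α β γ δ ∧ ‖α‖ ≠ ‖β‖ ∧ ‖γ‖ ≠ ‖δ‖) ∨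
    (¬ (¬ C.IsDiag → |W.p| ≠ |(C 0 0).re|) ∧ (∀ᶠ x in l, W.b x ≠ 0) ∧
      ∃ α β γ δ : ℂ, W.HasFactoredLimit l α β γ δ ∧ α ≠ 0 ∧ ‖α‖ = ‖β‖) := by
  have hent : ∀ i j, Tendsto (fun x => W.coinMatrix x i j) l (𝓝 (C i j)) := fun i j =>
    ((continuous_id.matrix_elem i j).tendsto C).comp hC
  set a := (C 0 0).re
  set a' := (C 1 1).re
  set b := C 1 0
  have h1 : Tendsto W.a₁ l (𝓝 a) := (Complex.continuous_re.tendsto _).comp (hent 0 0)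
  have h2 : Tendsto W.a₂ l (𝓝 a') := (Complex.continuous_re.tendsto _).comp (hent 1 1)
  have hb : Tendsto W.b l (𝓝 b) := hent 1 0
  have hb' : C 0 1 = conj b :=
    tendsto_nhds_unique (hent 0 1) ((Complex.continuous_conj.tendsto b).comp hb)
  have hab : a ^ 2 + ‖b‖ ^ 2 = 1 := by
    refine tendsto_nhds_unique ((h1.pow 2).add (hb.norm.pow 2)) ?_
    simp only [W.coin_cond₁, tendsto_const_nhds]
  have hdiag : C.IsDiag ↔ b = 0 := by
    constructor
    · intro h
      exact h (by decide)
    · intro h i j hij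
      fin_cases i <;> fin_cases j
      · exact absurd rfl hij
      · simpa [h] using hb'
      · exact h
      · exact absurd rfl hij
  have hcross : b * ((a : ℂ) + a') = 0 := by
    refine tendsto_nhds_unique (hb.mul (((Complex.continuous_ofReal.tendsto a).comp h1).add
      ((Complex.continuous_ofReal.tendsto a').comp h2))) ?_
    simp only [Function.comp_apply, W.coin_cond₃, tendsto_const_nhds]
  rw [hdiag]
  by_cases hb0 : b = 0
  · by_cases ha : a + a' = 0
    · rw [show a' = -a by linarith] at h2
      have ha0 : (a : ℂ) ≠ 0 := fun h => by
        simp [Complex.ofReal_eq_zero.mp h, hb0] at hab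
      -- Here the limit operator is the nonzero scalar -i|q|a, so constant factors suffice.
      refine Or.inr (Or.inl ⟨fun h => absurd hb0 h, 0, 1,
        (Complex.I / 2) * (‖W.q‖ * (-a - a)), 0, hasFactoredLimit_of hl h1 h2 hb ?_ ?_ ?_, ?_, ?_⟩)
      · simp [hb0]
      · ring
      · simp [hb0]
      · simp
      · rw [norm_zero, norm_ne_zero_iff, ← neg_add', ← two_mul]
        simp [ha0, W.q_ne_zero]
    · exact Or.inl ⟨fun h => absurd hb0 h, eventually_coeff_eq_zero hl h1 h2 ha⟩
  · have ha : a' = -a := by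
      have : a + a' = 0 := by exact_mod_cast (mul_eq_zero.mp hcross).resolve_left hb0
      linarith
    rw [ha] at h2
    obtain ⟨α, β, γ, δ, hlim, hα, hγ, e1, e2⟩ := exists_hasFactoredLimit hl h1 h2 hb hb0 hab
    by_cases hp : |W.p| = |a|
    · refine Or.inr (Or.inr ⟨fun h => h hb0 hp, hb.eventually_ne hb0, ?_⟩)
      rcases abs_eq_abs.mp hp with h | h
      · exact ⟨α, β, γ, δ, hlim, hα, e1.mpr h⟩
      -- For p = -a the second factor vanishes on the circle; the factors commute, so it is moved to
      -- the front.
      · exact ⟨γ, δ, α, β, hlim.swap, hγ, e2.mpr h⟩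
    · refine Or.inr (Or.inl ⟨fun _ => hp, α, β, γ, δ, hlim, fun h => hp ?_, fun h => hp ?_⟩)
      · rw [e1.mp h]
      · rw [e2.mp h, abs_neg]

end Limit

/-! ### Kernel recurrence and the alternative at each end -/

/-- With b ≠ 0 the coefficient of f(x + 1) is invertible, so the recurrence propagates two zeros to
the right; the left end uses the coefficient of f(x - 1) instead. -/
theorem eq_zero_of_ge {N : ℤ} (hN : ∀ x ≥ N, W.b x ≠ 0) {f : EllTwo} (hf : W.QepsPlus f = 0)
    (h0 : f N = 0) (h1 : f (N + 1) = 0) : ∀ x ∈ Set.Ici N, f x = 0 := by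
  have key : ∀ n : ℕ, f (N + n) = 0 ∧ f (N + n + 1) = 0 := fun n => by
    induction n with
    | zero => simpa using ⟨h0, h1⟩
    | succ n ih =>
      have h := W.isJacobi f (N + n + 1)
      rw [hf, add_sub_cancel_right, ih.1, ih.2] at h
      have h2 := (mul_eq_zero.mp (by simpa using h.symm : W.coeffU (N + n + 1) *
        f (N + n + 1 + 1) = 0)).resolve_left (W.coeffU_ne_zero (hN _ (by lia)))
      push_cast
      exact ⟨by rw [← add_assoc]; exact ih.2, by rw [← add_assoc]; exact h2⟩
  intro x hx
  obtain ⟨n, rfl⟩ := Int.le.dest hx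
  exact (key n).1

theorem eq_zero_of_le {N : ℤ} (hN : ∀ x ≤ N, W.b x ≠ 0) {f : EllTwo} (hf : W.QepsPlus f = 0)
    (h0 : f N = 0) (h1 : f (N - 1) = 0) : ∀ x ∈ Set.Iic N, f x = 0 := by
  have key : ∀ n : ℕ, f (N - n) = 0 ∧ f (N - n - 1) = 0 := fun n => by
    induction n with
    | zero => simpa using ⟨h0, h1⟩
    | succ n ih =>
      have h := W.isJacobi f (N - n - 1)
      rw [hf, sub_add_cancel, ih.1, ih.2] at h
      have h2 := (mul_eq_zero.mp (by simpa using h.symm : W.coeffW (N - n - 1) *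
        f (N - n - 1 - 1) = 0)).resolve_left (W.coeffW_ne_zero (hN _ (by lia)))
      push_cast
      exact ⟨by rw [← sub_sub]; exact ih.2, by rw [← sub_sub]; exact h2⟩
  intro x hx
  obtain ⟨n, hn⟩ := Int.le.dest hx.out
  rw [eq_sub_of_add_eq hn]
  exact (key n).1

theorem isClosed_map_of_coeff_eq_zero {S : Set ℤ}
    (h : ∀ x ∈ S, W.coeffU (x - 1) = 0 ∧ W.coeffV x = 0 ∧ W.coeffW (x + 1) = 0) :
    IsClosed ((supportedIn S).map W.QepsPlus.toLinearMap : Set EllTwo) := by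
  have h0 : (supportedIn S).map W.QepsPlus.toLinearMap = ⊥ := by
    rw [eq_bot_iff]
    rintro _ ⟨f, hf, rfl⟩
    have := W.isJacobi.norm_sub_laurentOp_le (u₀ := 0) (v₀ := 0) (w₀ := 0) le_rfl
      (fun x hx => by simp [h x hx]) hf
    simpa [laurentOp] using this
  rw [h0]
  exact isClosed_singleton

theorem isClosed_map_of_near {S : Set ℤ} {α β γ δ : ℂ} (hαβ : ‖α‖ ≠ ‖β‖) (hγδ : ‖γ‖ ≠ ‖δ‖)
    (h : ∀ x ∈ S, ‖W.coeffU (x - 1) - α * γ‖ ≤ |‖γ‖ - ‖δ‖| * |‖α‖ - ‖β‖| / 6 ∧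
      ‖W.coeffV x - (α * δ + β * γ)‖ ≤ |‖γ‖ - ‖δ‖| * |‖α‖ - ‖β‖| / 6 ∧
      ‖W.coeffW (x + 1) - β * δ‖ ≤ |‖γ‖ - ‖δ‖| * |‖α‖ - ‖β‖| / 6) :
    IsClosed ((supportedIn S).map W.QepsPlus.toLinearMap : Set EllTwo) :=
  isClosed_map_supportedIn (half_pos (mul_pos (abs_pos.mpr (sub_ne_zero.mpr hγδ))
    (abs_pos.mpr (sub_ne_zero.mpr hαβ)))) fun _ hf => W.isJacobi.le_norm_of_near h hf

/-- At each end, either the limit coin satisfies the criterion and `Q_{ε₊}` has closed range on the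
sequences supported near that end, or the criterion fails and the symbol vanishes somewhere. -/
theorem limit_dichotomy {l : Filter ℤ} [l.NeBot] {C : Matrix (Fin 2) (Fin 2) ℂ}
    (hl : Tendsto (fun x : ℤ => x + 1) l l) (hC : Tendsto W.coinMatrix l (𝓝 C)) :
    ((¬ C.IsDiag → |W.p| ≠ |(C 0 0).re|) ∧ ∃ S ∈ l, ∀ S' ⊆ S,
      IsClosed ((supportedIn S').map W.QepsPlus.toLinearMap : Set EllTwo)) ∨
    (¬ (¬ C.IsDiag → |W.p| ≠ |(C 0 0).re|) ∧ (∀ᶠ x in l, W.b x ≠ 0) ∧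
      ∃ α β γ δ : ℂ, W.HasFactoredLimit l α β γ δ ∧ α ≠ 0 ∧ ‖α‖ = ‖β‖) := by
  rcases limit_trichotomy hl hC with ⟨h1, h2⟩ | ⟨h1, α, β, γ, δ, h2, h3, h4⟩ | h
  · exact Or.inl ⟨h1, _, h2, fun S' hS' => W.isClosed_map_of_coeff_eq_zero fun x hx => hS' hx⟩
  · refine Or.inl ⟨h1, _, h2.eventually (ε := |‖γ‖ - ‖δ‖| * |‖α‖ - ‖β‖| / 6) ?_,
      fun S' hS' => W.isClosed_map_of_near h3 h4 fun x hx => hS' hx⟩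
    have := abs_pos.mpr (sub_ne_zero.mpr h3)
    have := abs_pos.mpr (sub_ne_zero.mpr h4)
    positivity
  · exact Or.inr h

theorem not_isClosed_range_atTop {α β γ δ : ℂ} (hb : ∀ᶠ x in atTop, W.b x ≠ 0)
    (hlim : W.HasFactoredLimit atTop α β γ δ) (hα : α ≠ 0) (hαβ : ‖α‖ = ‖β‖) :
    ¬ IsClosed (Set.range W.QepsPlus) := by
  obtain ⟨N, hN⟩ := eventually_atTop.mp hb
  refine W.isJacobi.not_isClosed_range (S := Set.Ici N) (γ := γ) (δ := δ)
    (fun f => W.eq_zero_of_ge hN) hα hαβ fun ε hε n => ?_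
  obtain ⟨M, hM⟩ := eventually_atTop.mp (hlim.eventually hε)
  exact ⟨max M N, fun x hx => ⟨(le_max_right M N).trans hx.1, hM x ((le_max_left M N).trans hx.1)⟩⟩

theorem not_isClosed_range_atBot {α β γ δ : ℂ} (hb : ∀ᶠ x in atBot, W.b x ≠ 0)
    (hlim : W.HasFactoredLimit atBot α β γ δ) (hα : α ≠ 0) (hαβ : ‖α‖ = ‖β‖) :
    ¬ IsClosed (Set.range W.QepsPlus) := by
  obtain ⟨N, hN⟩ := eventually_atBot.mp hb
  refine W.isJacobi.not_isClosed_range (S := Set.Iic N) (γ := γ) (δ := δ)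
    (fun f => W.eq_zero_of_le hN) hα hαβ fun ε hε n => ?_
  obtain ⟨M, hM⟩ := eventually_atBot.mp (hlim.eventually hε)
  -- The window has to end, not start, before both thresholds.
  refine ⟨min M N - n, fun x hx => ?_⟩
  have hx' : x < min M N := by linarith [hx.2]
  exact ⟨hx'.le.trans (min_le_right M N), hM x (hx'.le.trans (min_le_left M N))⟩

end SplitStep
end QuantumWalk

theorem mainTheorem4 (W : QuantumWalk.SplitStep) (CL CR : Matrix (Fin 2) (Fin 2) ℂ)
    (hC : W.IsAnisotropic CL CR) :
    IsClosed (Set.range W.QepsPlus) ↔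
      ((¬ CL.IsDiag → |W.p| ≠ |(CL 0 0).re|) ∧ (¬ CR.IsDiag → |W.p| ≠ |(CR 0 0).re|)) := by
  rcases W.limit_dichotomy (tendsto_atBot_add_const_right _ 1 tendsto_id) hC.1 with
    ⟨hL, S, hS, hSc⟩ | ⟨hL, hb, α, β, γ, δ, hlim, hα, hαβ⟩
  · rcases W.limit_dichotomy (tendsto_atTop_add_const_right _ 1 tendsto_id) hC.2 with
      ⟨hR, S', hS', hSc'⟩ | ⟨hR, hb, α, β, γ, δ, hlim, hα, hαβ⟩
    · refine iff_of_true ?_ ⟨hL, hR⟩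
      obtain ⟨M, hM⟩ := mem_atBot_sets.mp hS
      obtain ⟨N, hN⟩ := mem_atTop_sets.mp hS'
      -- The right threshold is pushed to at least M + 3 to provide the gap needed for disjoint
      -- images.
      exact W.isJacobi.isClosed_range (M := M) (N := max N (M + 3))
        (by linarith [le_max_right N (M + 3)]) (hSc _ hM)
        (hSc' _ fun x hx => hN x ((le_max_left _ _).trans hx))
    · exact iff_of_false (W.not_isClosed_range_atTop hb hlim hα hαβ) fun h => hR h.2
  · exact iff_of_false (W.not_isClosed_range_atBot hb hlim hα hαβ) fun h => hL h.1
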